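/- **Conventions.** A variety $\mathcal V$ is the class of all algebras of some signature that satisfy a given set of identities. For congruences $\alpha,\beta,\delta$ of an algebra $\mathbf A$, write $C(\alpha,\beta;\delta)$ if for all polynomial operations $f$ of $\mathbf A$ and all tuples $\mathbf a\mathrel{\alpha}\mathbf b$, $\mathbf u\mathrel{\beta}\mathbf v$ (coordinatewise), $f(\mathbf a,\mathbf u)\mathrel{\delta}f(\mathbf a,\mathbf v)$ implies $f(\mathbf b,\mathbf u)\mathrel{\delta}f(\mathbf b,\mathbf v)$. The commutator $[\alpha,\beta]$ is the least congruence $\delta$ with $C(\alpha,\beta;\delta)$, and $\mathbf A$ is abelian if $C(1,1;0)$, i.e. $[1,1]=0$. For terms $s,t$ in variables $x_1,\dots,x_n$, $\mathbf A$ satisfies the commutator equation $s\approx_C t$ if $s(a_1,\dots,a_n)\mathrel{[\theta,\theta]}t(a_1,\dots,a_n)$ for every congruence $\theta$ of $\mathbf A$ and all $a_1,\dots,a_n$ lying in one $\theta$-class. A term $t$ is idempotent in $\mathcal V$ if $\mathcal V\models t(x,\dots,x)\approx x$. The idempotent reduct of $\mathcal V$ is the variety, in the signature whose operation symbols are the idempotent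 terms of $\mathcal V$, generated by the algebras obtained from the members of $\mathcal V$ by taking the corresponding term operations as basic operations. Terms in the language $\{\circ,\wedge,\vee\}$ in variables $X_s$ $(s\in I)$ are evaluated at congruences of an algebra with $\circ$ the relational product, $\wedge$ the intersection, and $R\vee S=\bigcup_{k\ge 1}R\circ^{(k)}S$, where $R\circ^{(k)}S=R\circ S\circ R\circ\cdots$ with $k$ factors (for congruences this is their join). For such a term $p$ and $k\ge 1$, $p^{(k)}$ is the $\{\circ,\wedge\}$-term obtained from $p$ by replacing every $\vee$ by $\circ^{(k)}$. An algebra satisfies $p\le q$ if $p(\theta)\subseteq q(\theta)$ for every assignment $\theta$ of congruences of the algebra to the variables. The labelled graph $\mathbf G(p)$ of a $\{\circ,\wedge\}$-term $p$ is obtained from a single edge $(x_1,x_2)$ labelled $p$ by repeating the following steps until all labels are variables: replace an edge $(x,y)$ labelled $u\wedge v$ by two edges $(x,y)$ labelled $u$ and $v$; replace an edge $(x,y)$ labelled $u\circ v$ by edges $(x,z)$ labelled $u$ and $(z,y)$ labelled $v$, where $z$ is a new vertex. Let $p,q$ be $\{\circ,\wedge\}$-terms, let $x_1,\dots,x_n$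 be the vertices of $\mathbf G(p)$, and let $z_1,\dots,z_r$ be those of $\mathbf G(q)$, where $(x_1,x_2)$ and $(z_1,z_2)$ are the initial edges. $\mathcal V$ satisfies $\mathrm{Eq}_C(p\le q)$ if there are $n$-ary terms $t_1,\dots,t_r$ of $\mathcal V$ in the variables $x_1,\dots,x_n$, with $t_1=x_1$ and $t_2=x_2$, such that every member of $\mathcal V$ satisfies $$t_i(\sigma_s(x_1),\dots,\sigma_s(x_n))\approx_C t_j(\sigma_s(x_1),\dots,\sigma_s(x_n))$$ for every variable $X_s$, every edge $(z_i,z_j)$ of $\mathbf G(q)$ with label $X_s$, and every transversal $\sigma_s$ of the equivalence relation generated by the edges of $\mathbf G(p)$ with label $X_s$ (that is, every map sending all elements of each class to one fixed element of that class). For $\{\circ,\wedge,\vee\}$-terms $p,q$, $\mathcal V$ satisfies $\mathrm{Eq}_C(p\le q)$ if for every $l\ge 1$ there is $k\ge 1$ such that $\mathcal V$ satisfies $\mathrm{Eq}_C(p^{(l)}\le q^{(k)})$. **Theorem.** Let $\mathcal V$ be a variety and let $p,q$ be terms in the language $\{\circ,\wedge,\vee\}$. The following are equivalent: 1. every abelian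 algebra in the idempotent reduct of $\mathcal V$ satisfies $p\le q$; 2. $\mathcal V$ satisfies the commutator equations $\mathrm{Eq}_C(p\le q)$. -/

import Mathlib

universe u v w x z

namespace CommEq

/-! ### Algebras, congruences and the term-condition commutator

An algebra over the signature `L` is a type `A` with `[L.Structure A]`, where `L` is a first-order
language (whose relation symbols, if any, play no role below). -/

section Algebra

variable (L : FirstOrder.Language.{u, v}) {A : Type w} [L.Structure A]

/-- The equivalence relation `r` is a congruence of the algebra `A`. -/
def IsCongruence (r : Setoid A) : Prop :=
  ∀ (n : ℕ) (f : L.Functions n) (a b : Fin n → A),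
    (∀ i, r (a i) (b i)) → r (FirstOrder.Language.Structure.funMap f a) (FirstOrder.Language.Structure.funMap f b)

/-- The polynomial operation of `A` in two blocks of variables given by a term `f` in these
variables and in constants from `A`. -/
def polyEval {n m : ℕ} (f : L.Term (A ⊕ (Fin n ⊕ Fin m))) (a : Fin n → A) (c : Fin m → A) : A :=
  f.realize (Sum.elim id (Sum.elim a c))

/-- The centralizer relation `C(α, β; δ)`. -/
def Centralizes (α β δ : Setoid A) : Prop :=
  ∀ (n m : ℕ) (f : L.Term (A ⊕ (Fin n ⊕ Fin m))) (a b : Fin n → A) (c d : Fin m → A),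
    (∀ i, α (a i) (b i)) → (∀ j, β (c j) (d j)) →
      δ (polyEval L f a c) (polyEval L f a d) → δ (polyEval L f b c) (polyEval L f b d)

/-- The term-condition commutator `[α, β]`: the least congruence `δ` with `C(α, β; δ)`, obtained
as the intersection of all of them. -/
def tcCommutator (α β : Setoid A) : Setoid A :=
  sInf {δ | IsCongruence L δ ∧ Centralizes L α β δ}

variable (A) in
/-- The algebra `A` is abelian: `C(1, 1; 0)`, that is, `[1, 1] = 0`. -/
def IsAbelian : Prop :=
  Centralizes L (⊤ : Setoid A) ⊤ ⊥

variable (A) in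
/-- `A` satisfies the term equation `s ≈ t`. -/
def SatisfiesEq {X : Type x} (s t : L.Term X) : Prop :=
  ∀ a : X → A, s.realize a = t.realize a

variable (A) in
/-- `A` satisfies the commutator equation `s ≈_C t`. -/
def SatisfiesCommEq {X : Type x} (s t : L.Term X) : Prop :=
  ∀ θ : Setoid A, IsCongruence L θ → ∀ a : X → A, (∀ i j, θ (a i) (a j)) →
    tcCommutator L θ θ (s.realize a) (t.realize a)

end Algebra

/-! ### Varieties and idempotent reducts -/

/-- A variety over the signature `L`, presented as the class of all models of a set of identities
in countably many variables. -/
structure Variety (L : FirstOrder.Language.{u, v}) where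
  identities : Set (L.Term ℕ × L.Term ℕ)

namespace Variety

variable {L : FirstOrder.Language.{u, v}} (V : Variety L)

/-- The algebra `A` belongs to the variety `V`. -/
def Mem (A : Type w) [L.Structure A] : Prop :=
  ∀ e ∈ V.identities, SatisfiesEq L A e.1 e.2

/-- The term `t` is idempotent in `V`: `V` satisfies `t(x, …, x) ≈ x`. -/
def IsIdempotent {n : ℕ} (t : L.Term (Fin n)) : Prop :=
  ∀ (A : Type w) [L.Structure A], V.Mem A → ∀ a : A, t.realize (fun _ => a) = a

/-- The signature of the idempotent reduct: its operation symbols are the idempotent terms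
of `V`. -/
def idemLang : FirstOrder.Language.{u, 0} where
  Functions n := {t : L.Term (Fin n) // IsIdempotent.{u, v, w} V t}
  Relations _ := Empty

/-- The idempotent reduct of an `L`-algebra: every idempotent term of `V` acts as the corresponding
term operation. -/
@[reducible]
def idemStructure (A : Type w) [L.Structure A] : (idemLang.{u, v, w} V).Structure A where
  funMap t a := t.1.realize a
  RelMap r := r.elim

/-- The idempotent reduct of the variety `V`: the variety generated by the idempotent reducts of
the members of `V`, that is, the class of models of all identities that hold in all these
reducts. -/
def idemReduct : Variety (idemLang.{u, v, w} V) where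
  identities := {e | ∀ (A : Type w) [L.Structure A], V.Mem A →
    @SatisfiesEq (idemLang.{u, v, w} V) A (V.idemStructure A) ℕ e.1 e.2}

end Variety

/-! ### Terms in the languages `{∘, ∧}` and `{∘, ∧, ∨}` -/

/-- Terms in the language `{∘, ∧}` with variables `X_s`, `s : ι`. -/
inductive RegTerm (ι : Type z) : Type z
  | var : ι → RegTerm ι
  | meet : RegTerm ι → RegTerm ι → RegTerm ι
  | comp : RegTerm ι → RegTerm ι → RegTerm ι

/-- Terms in the language `{∘, ∧, ∨}` with variables `X_s`, `s : ι`. -/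
inductive RelTerm (ι : Type z) : Type z
  | var : ι → RelTerm ι
  | meet : RelTerm ι → RelTerm ι → RelTerm ι
  | comp : RelTerm ι → RelTerm ι → RelTerm ι
  | join : RelTerm ι → RelTerm ι → RelTerm ι

/-- The alternating relational product `P ∘ Q ∘ P ∘ ⋯` with `k + 1` factors. -/
def RegTerm.alt {ι : Type z} : ℕ → RegTerm ι → RegTerm ι → RegTerm ι
  | 0, P, _ => P
  | k + 1, P, Q => RegTerm.comp P (RegTerm.alt k Q P)

namespace RelTerm

variable {ι : Type z}

/-- `p.expand k` is the `{∘, ∧}`-term `p^(k+1)`, obtained from `p` by replacing every join `P ∨ Q`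
by the alternating product `P ∘ Q ∘ P ∘ ⋯` with `k + 1` factors. -/
def expand (k : ℕ) : RelTerm ι → RegTerm ι
  | var s => RegTerm.var s
  | meet P Q => RegTerm.meet (P.expand k) (Q.expand k)
  | comp P Q => RegTerm.comp (P.expand k) (Q.expand k)
  | join P Q => RegTerm.alt k (P.expand k) (Q.expand k)

/-- The value of a term at binary relations: `∧` is intersection, `∘` is relational product, and
`P ∨ Q` is the transitive closure of the union. For reflexive relations the latter is the union
of the products `P ∘ Q ∘ P ∘ ⋯`, and for congruences it is the join of congruences. -/
def eval {A : Type w} (R : ι → A → A → Prop) : RelTerm ι → A → A → Prop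
  | var s => R s
  | meet P Q => fun a b => P.eval R a b ∧ Q.eval R a b
  | comp P Q => Relation.Comp (P.eval R) (Q.eval R)
  | join P Q => Relation.TransGen (fun a b => P.eval R a b ∨ Q.eval R a b)

end RelTerm

/-- The algebra `A` satisfies the congruence inclusion `p ≤ q`. -/
def SatisfiesIncl (L : FirstOrder.Language.{u, v}) (A : Type w) [L.Structure A] {ι : Type z}
    (p q : RelTerm ι) : Prop :=
  ∀ θ : ι → Setoid A, (∀ s, IsCongruence L (θ s)) →
    ∀ a b : A, p.eval (fun s => (θ s).r) a b → q.eval (fun s => (θ s).r) a b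

/-! ### The labelled graph of a `{∘, ∧}`-term -/

namespace RegTerm

variable {ι : Type z}

/-- The vertices of the labelled graph of a term other than the two end points: splitting an edge
labelled by a meet creates no vertex, splitting an edge labelled by a product creates one. -/
def Inner : RegTerm ι → Type
  | var _ => Empty
  | meet P Q => Inner P ⊕ Inner Q
  | comp P Q => Unit ⊕ (Inner P ⊕ Inner Q)

/-- Draw the labelled graph of a term between the points `a` and `b` of `W`, the inner vertices
being placed by `e`. `HasEdge p a b e s c d` says that the resulting graph has an edge from `c` to
`d` with label `X_s`. -/
def HasEdge {W : Type w} :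
    (p : RegTerm ι) → (a b : W) → (e : Inner p → W) → (s : ι) → (c d : W) → Prop
  | var r, a, b, _, s, c, d => s = r ∧ c = a ∧ d = b
  | meet P Q, a, b, e, s, c, d =>
      HasEdge P a b (fun i => e (Sum.inl i)) s c d ∨ HasEdge Q a b (fun i => e (Sum.inr i)) s c d
  | comp P Q, a, b, e, s, c, d =>
      HasEdge P a (e (Sum.inl ())) (fun i => e (Sum.inr (Sum.inl i))) s c d ∨
        HasEdge Q (e (Sum.inl ())) b (fun i => e (Sum.inr (Sum.inr i))) s c d

/-- The vertices of the labelled graph `G(p)`: the two end points and the inner vertices. -/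
def Vertex (p : RegTerm ι) : Type := Bool ⊕ Inner p

/-- The initial vertex `x₁` of `G(p)`. -/
def source (p : RegTerm ι) : Vertex p := Sum.inl false

/-- The terminal vertex `x₂` of `G(p)`. -/
def target (p : RegTerm ι) : Vertex p := Sum.inl true

/-- `(c, d)` is an edge of `G(p)` with label `X_s`. -/
def Edge (p : RegTerm ι) (s : ι) (c d : Vertex p) : Prop :=
  HasEdge p p.source p.target Sum.inr s c d

/-- `σ` is a transversal of the equivalence relation generated by the edges of `G(p)` with label
`X_s`: it maps all elements of a class to one fixed element of that class. -/
def IsTransversal (p : RegTerm ι) (s : ι) (σ : Vertex p → Vertex p) : Prop :=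
  (∀ c, Relation.EqvGen (p.Edge s) c (σ c)) ∧
    ∀ c d, Relation.EqvGen (p.Edge s) c d → σ c = σ d

end RegTerm

/-! ### The commutator equations of a congruence inclusion -/

/-- The pairs of terms `(l, r)` such that `l ≈_C r` is one of the equations of `Eq_C(p ≤ q)` for the
family `t` of terms, which are indexed by the vertices of `G(q)` and whose variables are the
vertices of `G(p)`. -/
def commEqs {L : FirstOrder.Language.{u, v}} {ι : Type z} (p q : RegTerm ι)
    (t : q.Vertex → L.Term p.Vertex) : Set (L.Term p.Vertex × L.Term p.Vertex) :=
  {e | ∃ (s : ι) (i j : q.Vertex) (σ : p.Vertex → p.Vertex),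
    q.Edge s i j ∧ p.IsTransversal s σ ∧ e = ((t i).relabel σ, (t j).relabel σ)}

/-- The variety `V` satisfies `Eq_C(p ≤ q)` for `{∘, ∧}`-terms `p`, `q`: there are terms indexed by
the vertices of `G(q)`, the variables `x₁`, `x₂` at the two end points, for which all the commutator
equations hold in all members of `V`. -/
def Variety.SatisfiesRegCommEqs {L : FirstOrder.Language.{u, v}} (V : Variety L) {ι : Type z}
    (p q : RegTerm ι) : Prop :=
  ∃ t : q.Vertex → L.Term p.Vertex,
    t q.source = FirstOrder.Language.Term.var p.source ∧ t q.target = FirstOrder.Language.Term.var p.target ∧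
      ∀ e ∈ commEqs p q t, ∀ (A : Type w) [L.Structure A], V.Mem A → SatisfiesCommEq L A e.1 e.2

/-- The variety `V` satisfies `Eq_C(p ≤ q)` for `{∘, ∧, ∨}`-terms `p`, `q`: for every `l ≥ 1` there
is a `k ≥ 1` such that `V` satisfies `Eq_C(p^(l) ≤ q^(k))`. -/
def Variety.SatisfiesCommEqs {L : FirstOrder.Language.{u, v}} (V : Variety L) {ι : Type z}
    (p q : RelTerm ι) : Prop :=
  ∀ l : ℕ, ∃ k : ℕ, Variety.SatisfiesRegCommEqs.{u, v, w, z} V (p.expand l) (q.expand k)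

end CommEq

-- Both directions move between members of the variety and abelian algebras of its idempotent
-- reduct.
--
-- From inclusions to equations. Idempotent terms preserve each class of a congruence α, and such a
-- class modulo [α,α] is an abelian algebra of the reduct (`exists_abelian_quotient`). In the free
-- abelian algebra of the reduct over the vertices of G(p), with one congruence for each edge label,
-- the generators witness `p`. Hence some elements witness `q`, and terms representing them are the
-- required terms. An edge of G(q) becomes an identity of abelian algebras once the variables are
-- identified along a transversal; read in a class modulo [α,α], it is a commutator equation.
--
-- From equations to inclusions. The equations force the terms to be idempotent, so applying them to
-- a copy of G(p) in an abelian algebra A of the reduct should give a copy of G(q). This requires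
-- that a commutator equation between idempotent terms be a true equation in A
-- (`value_eq_of_satisfiesCommEq`), although A need not come from a member of the variety. For an
-- assignment of the generators of the free algebra to elements of A, `separation` is a congruence
-- that keeps idempotent elements with different values apart. It must be shown to contain the
-- commutator of the congruence `collapse` with itself.
--
-- That is a term condition for four idempotent terms (`value_termCondition`). Their common pattern
-- involves terms that need not be idempotent, so abelianness of A does not apply directly. It
-- follows from `TermCondition.switch`, which transports an equality of two different idempotent
-- operations along one argument; the proof uses the medial law for idempotent binary operations.

universe y

namespace CommEq

/-! ### The term condition for an abstract set of matrices -/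

/-- A set `M` of `2 × 2` matrices (first row `w x`, second row `y z`) that contains the matrices with
constant rows and those with constant columns, and satisfies the term condition. -/
structure TermCondition {A : Type w} (M : A → A → A → A → Prop) : Prop where
  row : ∀ a b, M a a b b
  col : ∀ c d, M c d c d
  cancel : ∀ {a b c d}, a = b → M a b c d → c = d

/-- The operation `h` preserves the set `M` of matrices. -/
def PreservesMat {A : Type w} (M : A → A → A → A → Prop) {Z : Type x} (h : A → (Z → A) → A) : Prop :=
  ∀ {a b c d : A} {a' b' c' d' : Z → A}, M a b c d → (∀ i, M (a' i) (b' i) (c' i) (d' i)) →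
    M (h a a') (h b b') (h c c') (h d d')

namespace TermCondition

variable {A : Type w} {M : A → A → A → A → Prop}

/-- With b and c outside as well as inside, both sides collapse to s(b, c) by idempotence. The
columns of the matrix exchange the two middle arguments; the rows replace the outer ones by a and d.
-/
theorem medial (hM : TermCondition M) (s : A → A → A)
    (hs : ∀ {a b c d a' b' c' d'}, M a b c d → M a' b' c' d' → M (s a a') (s b b') (s c c') (s d d'))
    (hid : ∀ a, s a a = a) (a b c d : A) : s (s a b) (s c d) = s (s a c) (s b d) :=
  hM.cancel (a := s (s b b) (s c c)) (b := s (s b c) (s b c)) (by simp only [hid])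
    (hs (hs (hM.row _ _) (hM.col _ _)) (hs (hM.col _ _) (hM.row _ _)))

/-- If two idempotent operations agree whenever all but the first argument coincide, then the
validity of `h₁(x, z) = h₂(x, z)` does not depend on `x`. -/
theorem switch (hM : TermCondition M) {Z : Type x} {h₁ h₂ : A → (Z → A) → A}
    (hp₁ : PreservesMat M h₁) (hp₂ : PreservesMat M h₂)
    (id₁ : ∀ a, h₁ a (fun _ => a) = a) (id₂ : ∀ a, h₂ a (fun _ => a) = a)
    (h₁₂ : ∀ a o, h₂ a (fun _ => o) = h₁ a (fun _ => o)) (x y : A) (z : Z → A)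
    (hx : h₁ x z = h₂ x z) : h₁ y z = h₂ y z := by
  obtain ⟨s, hs⟩ : ∃ s : A → A → A, ∀ a o, h₁ a (fun _ => o) = s a o := ⟨_, fun _ _ => rfl⟩
  have hs₂ : ∀ a o, h₂ a (fun _ => o) = s a o := fun a o => (h₁₂ a o).trans (hs a o)
  have sid : ∀ a, s a a = a := fun a => by rw [← hs, id₁]
  have sp : ∀ {a b c d a' b' c' d'}, M a b c d → M a' b' c' d' →
      M (s a a') (s b b') (s c c') (s d d') := by
    intro a b c d a' b' c' d' m m'
    simp only [← hs]
    exact hp₁ m fun _ => m'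
  have med := hM.medial s sp sid
  -- Composing the two operations makes both h₁(a, z) and h₂(a, z) values of the single operation T,
  -- so the term condition can compare them.
  obtain ⟨T, hT⟩ : ∃ T : A → (Z → A) → (Z → A) → (Z → Z → A) → A,
      ∀ A₀ B C D, T A₀ B C D = h₁ (h₂ A₀ B) (fun i => h₂ (C i) (D i)) := ⟨_, fun _ _ _ _ => rfl⟩
  have Tp : ∀ {a b c d} {a₁ b₁ c₁ d₁ a₂ b₂ c₂ d₂ : Z → A} {a₃ b₃ c₃ d₃ : Z → Z → A}, M a b c d →
      (∀ i, M (a₁ i) (b₁ i) (c₁ i) (d₁ i)) → (∀ i, M (a₂ i) (b₂ i) (c₂ i) (d₂ i)) →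
      (∀ i j, M (a₃ i j) (b₃ i j) (c₃ i j) (d₃ i j)) →
      M (T a a₁ a₂ a₃) (T b b₁ b₂ b₃) (T c c₁ c₂ c₃) (T d d₁ d₂ d₃) := by
    intro a b c d a₁ b₁ c₁ d₁ a₂ b₂ c₂ d₂ a₃ b₃ c₃ d₃ m m₁ m₂ m₃
    simp only [hT]
    exact hp₁ (hp₂ m m₁) fun i => hp₂ (m₂ i) (m₃ i)
  have T_const : ∀ a b c d, T a (fun _ => b) (fun _ => c) (fun _ _ => d) = s (s a b) (s c d) := by
    intro a b c d
    simp only [hT, hs₂, hs]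
  have T_left : ∀ a, T a (fun _ => a) z (fun i _ => z i) = h₁ a z := by
    intro a
    simp only [hT, id₂]
  have T_right : ∀ a, T a z (fun _ => a) (fun _ => z) = h₂ a z := by
    intro a
    simp only [hT, id₁]
  have R := hM.row
  have K := hM.col
  -- Only the first argument of T moves from x to y here. The remaining x, in the second block on
  -- one side and in the third on the other, still has to become y.
  have given : T y (fun _ => x) z (fun i _ => z i) = T y z (fun _ => x) (fun _ => z) :=
    hM.cancel (a := T x (fun _ => x) z (fun i _ => z i)) (b := T x z (fun _ => x) (fun _ => z))
      (by rw [T_left, T_right, hx])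
      (Tp (R _ _) (fun _ => K _ _) (fun _ => K _ _) (fun _ _ => K _ _))
  -- On constant blocks T is s(s(a, b), s(c, d)), where b and c each sit below one left and one
  -- right turn. By the medial law either one can be exchanged with the innermost argument of s(s(·,
  -- c₁), c₂) beside T, and the term condition extends this to arbitrary arguments. So the leftover
  -- x's can be traded for y's at the cost of the same factor on both sides.
  have left : ∃ k, s (h₁ y z) k = s (h₂ y z) k := by
    have swap₁ : ∀ b e A₀ C D c₁ c₂, s (T A₀ (fun _ => b) C D) (s (s e c₁) c₂) =
        s (T A₀ (fun _ => e) C D) (s (s b c₁) c₂) := by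
      intro b e A₀ C D c₁ c₂
      refine hM.cancel (a := s (T b (fun _ => b) (fun _ => b) (fun _ _ => b)) (s (s e b) b))
        (b := s (T b (fun _ => e) (fun _ => b) (fun _ _ => b)) (s (s b b) b)) ?_
        (sp (Tp (R _ _) (fun _ => K _ _) (fun _ => R _ _) (fun _ _ => R _ _))
          (sp (sp (K _ _) (R _ _)) (R _ _)))
      rw [T_const, T_const, med (s b b) (s b b) (s e b) b, med b b e b, ← med]
    have swap₂ : ∀ c e A₀ B D c₁ c₂, s (T A₀ B (fun _ => c) D) (s (s e c₁) c₂) =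
        s (T A₀ B (fun _ => e) D) (s (s c c₁) c₂) := by
      intro c e A₀ B D c₁ c₂
      refine hM.cancel (a := s (T c (fun _ => c) (fun _ => c) (fun _ _ => c)) (s (s e c) c))
        (b := s (T c (fun _ => c) (fun _ => e) (fun _ _ => c)) (s (s c c) c)) ?_
        (sp (Tp (R _ _) (fun _ => R _ _) (fun _ => K _ _) (fun _ _ => R _ _))
          (sp (sp (K _ _) (R _ _)) (R _ _)))
      rw [T_const, T_const, med]
    refine ⟨s (s x x) x, ?_⟩
    rw [← T_left, ← T_right, swap₁ y x, swap₂ y x]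
    exact congrArg (s · (s (s y x) x)) given
  -- The mirror image, with the compensating factor on the left of T.
  have right : ∃ k, s k (h₁ y z) = s k (h₂ y z) := by
    have swap₁ : ∀ b e A₀ C D c₁ c₂, s (s c₁ (s c₂ e)) (T A₀ (fun _ => b) C D) =
        s (s c₁ (s c₂ b)) (T A₀ (fun _ => e) C D) := by
      intro b e A₀ C D c₁ c₂
      refine hM.cancel (a := s (s b (s b e)) (T b (fun _ => b) (fun _ => b) (fun _ _ => b)))
        (b := s (s b (s b b)) (T b (fun _ => e) (fun _ => b) (fun _ _ => b))) ?_
        (sp (sp (R _ _) (sp (R _ _) (K _ _)))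
          (Tp (R _ _) (fun _ => K _ _) (fun _ => R _ _) (fun _ _ => R _ _)))
      rw [T_const, T_const, med]
    have swap₂ : ∀ c e A₀ B D c₁ c₂, s (s c₁ (s c₂ e)) (T A₀ B (fun _ => c) D) =
        s (s c₁ (s c₂ c)) (T A₀ B (fun _ => e) D) := by
      intro c e A₀ B D c₁ c₂
      refine hM.cancel (a := s (s c (s c e)) (T c (fun _ => c) (fun _ => c) (fun _ _ => c)))
        (b := s (s c (s c c)) (T c (fun _ => c) (fun _ => e) (fun _ _ => c))) ?_
        (sp (sp (R _ _) (sp (R _ _) (K _ _)))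
          (Tp (R _ _) (fun _ => R _ _) (fun _ => K _ _) (fun _ _ => R _ _)))
      rw [T_const, T_const, med c (s c e) (s c c), med c e c c, ← med]
    refine ⟨s x (s x x), ?_⟩
    rw [← T_left, ← T_right, swap₁ y x, swap₂ y x]
    exact congrArg (s (s x (s x y))) given
  obtain ⟨k, hk⟩ := left
  obtain ⟨k', hk'⟩ := right
  -- The operation s need not be cancellative; the term condition replaces the common factor, first
  -- by h₁(y, z) and then by h₂(y, z), and idempotence finishes.
  calc h₁ y z = s (h₁ y z) (h₁ y z) := (sid _).symm
    _ = s (h₂ y z) (h₁ y z) := hM.cancel hk (sp (K _ _) (R _ _))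
    _ = s (h₂ y z) (h₂ y z) := hM.cancel hk' (sp (R _ _) (K _ _))
    _ = h₂ y z := sid _

end TermCondition

/-! ### Graphs and values of terms -/

namespace RegTerm

variable {ι : Type z}

theorem hasEdge_map {W : Type w} {W' : Type x} (g : W → W') (p : RegTerm ι) (a b : W)
    (e : Inner p → W) (s : ι) (c d : W') :
    HasEdge p (g a) (g b) (fun i => g (e i)) s c d ↔
      ∃ c' d', HasEdge p a b e s c' d' ∧ g c' = c ∧ g d' = d := by
  induction p generalizing a b with
  | var r =>
    constructor
    · rintro ⟨rfl, rfl, rfl⟩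
      exact ⟨a, b, ⟨rfl, rfl, rfl⟩, rfl, rfl⟩
    · rintro ⟨_, _, ⟨rfl, rfl, rfl⟩, rfl, rfl⟩
      exact ⟨rfl, rfl, rfl⟩
  | meet P Q ihP ihQ =>
    simp only [HasEdge, ihP a b fun i => e (Sum.inl i), ihQ a b fun i => e (Sum.inr i),
      or_and_right, exists_or]
  | comp P Q ihP ihQ =>
    simp only [HasEdge, ihP a (e (Sum.inl ())) fun i => e (Sum.inr (Sum.inl i)),
      ihQ (e (Sum.inl ())) b fun i => e (Sum.inr (Sum.inr i)), or_and_right, exists_or]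

/-- The map on the vertices of `G(p)` given by the images of the end points and of the inner
vertices. -/
def place {W : Type w} {p : RegTerm ι} (a b : W) (e : Inner p → W) : p.Vertex → W :=
  Sum.elim (fun i => if i then b else a) e

theorem hasEdge_place {W : Type w} {p : RegTerm ι} {a b : W} {e : Inner p → W} {s : ι}
    {c d : p.Vertex} (h : p.Edge s c d) : HasEdge p a b e s (place a b e c) (place a b e d) :=
  (hasEdge_map (place a b e) p p.source p.target Sum.inr s _ _).2 ⟨c, d, h, rfl, rfl⟩

instance finite_inner (p : RegTerm ι) : Finite p.Inner := by
  induction p with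
  | var r => exact inferInstanceAs (Finite Empty)
  | meet P Q ihP ihQ => exact inferInstanceAs (Finite (Inner P ⊕ Inner Q))
  | comp P Q ihP ihQ => exact inferInstanceAs (Finite (Unit ⊕ (Inner P ⊕ Inner Q)))

instance finite_vertex (p : RegTerm ι) : Finite p.Vertex :=
  inferInstanceAs (Finite (Bool ⊕ Inner p))

/-- The graph of a term is connected. -/
theorem constant_of_hasEdge {W : Type w} {B : Type x} (g : W → B) (p : RegTerm ι) (a b : W)
    (e : Inner p → W) (h : ∀ s c d, HasEdge p a b e s c d → g c = g d) :
    g b = g a ∧ ∀ i, g (e i) = g a := by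
  induction p generalizing a b with
  | var r => exact ⟨(h r a b ⟨rfl, rfl, rfl⟩).symm, fun i => nomatch i⟩
  | meet P Q ihP ihQ =>
    have hP := ihP a b _ fun s c d hc => h s c d (Or.inl hc)
    have hQ := ihQ a b _ fun s c d hc => h s c d (Or.inr hc)
    exact ⟨hP.1, fun | .inl i => hP.2 i | .inr i => hQ.2 i⟩
  | comp P Q ihP ihQ =>
    have hP := ihP _ _ _ fun s c d hc => h s c d (Or.inl hc)
    have hQ := ihQ _ _ _ fun s c d hc => h s c d (Or.inr hc)
    exact ⟨hQ.1.trans hP.1,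
      fun | .inl () => hP.1 | .inr (.inl i) => hP.2 i | .inr (.inr i) => (hQ.2 i).trans hP.1⟩

theorem constant_of_edge {B : Type x} (p : RegTerm ι) (g : p.Vertex → B)
    (h : ∀ s c d, p.Edge s c d → g c = g d) (i : p.Vertex) : g i = g p.source := by
  have hc := constant_of_hasEdge g p p.source p.target Sum.inr h
  match i with
  | .inl false => rfl
  | .inl true => exact hc.1
  | .inr i => exact hc.2 i

theorem exists_isTransversal (p : RegTerm ι) (s : ι) : ∃ σ, p.IsTransversal s σ := by
  let r : Setoid p.Vertex := Relation.EqvGen.setoid (p.Edge s)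
  refine ⟨fun c => (Quotient.mk r c).out, fun c => ?_, fun c d h => ?_⟩
  · exact r.symm (Quotient.mk_out (s := r) c)
  · exact congrArg Quotient.out (Quotient.sound (s := r) h)

/-- The value of a `{∘, ∧}`-term at binary relations. -/
def eval {A : Type w} (R : ι → A → A → Prop) : RegTerm ι → A → A → Prop
  | var s => R s
  | meet P Q => fun a b => P.eval R a b ∧ Q.eval R a b
  | comp P Q => Relation.Comp (P.eval R) (Q.eval R)

theorem eval_iff_exists_inner {A : Type w} (R : ι → A → A → Prop) (p : RegTerm ι) (a b : A) :
    p.eval R a b ↔ ∃ e : Inner p → A, ∀ s c d, HasEdge p a b e s c d → R s c d := by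
  induction p generalizing a b with
  | var r =>
    constructor
    · intro h
      refine ⟨nofun, ?_⟩
      rintro s c d ⟨rfl, rfl, rfl⟩
      exact h
    · rintro ⟨e, h⟩
      exact h _ _ _ ⟨rfl, rfl, rfl⟩
  | meet P Q ihP ihQ =>
    simp only [eval, ihP, ihQ]
    constructor
    · rintro ⟨⟨e, he⟩, f, hf⟩
      exact ⟨Sum.elim e f, fun s c d h => h.elim (he s c d) (hf s c d)⟩
    · rintro ⟨e, he⟩
      exact ⟨⟨_, fun s c d h => he s c d (Or.inl h)⟩, _, fun s c d h => he s c d (Or.inr h)⟩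
  | comp P Q ihP ihQ =>
    simp only [eval, Relation.Comp, ihP, ihQ]
    constructor
    · rintro ⟨m, ⟨e, he⟩, f, hf⟩
      exact ⟨Sum.elim (fun _ => m) (Sum.elim e f), fun s c d h => h.elim (he s c d) (hf s c d)⟩
    · rintro ⟨e, he⟩
      exact ⟨e (Sum.inl ()), ⟨_, fun s c d h => he s c d (Or.inl h)⟩,
        _, fun s c d h => he s c d (Or.inr h)⟩

section Refl

variable {A : Type w} {R : ι → A → A → Prop}

theorem eval_refl (hR : ∀ s a, R s a a) (p : RegTerm ι) (a : A) : p.eval R a a := by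
  induction p with
  | var r => exact hR r a
  | meet P Q ihP ihQ => exact ⟨ihP, ihQ⟩
  | comp P Q ihP ihQ => exact ⟨a, ihP, ihQ⟩

theorem eval_alt_mono (hR : ∀ s a, R s a a) {k k' : ℕ} (hk : k ≤ k') {P P' Q Q' : RegTerm ι}
    (hP : ∀ a b, P.eval R a b → P'.eval R a b) (hQ : ∀ a b, Q.eval R a b → Q'.eval R a b) (a b : A)
    (h : (alt k P Q).eval R a b) : (alt k' P' Q').eval R a b := by
  induction k' generalizing k P P' Q Q' a b with
  | zero =>
    obtain rfl : k = 0 := by omega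
    exact hP a b h
  | succ k' ih =>
    cases k with
    | zero => exact ⟨b, hP a b h, eval_refl hR _ b⟩
    | succ k =>
      obtain ⟨m, h, h'⟩ := h
      exact ⟨m, hP a m h, ih (by omega) hQ hP m b h'⟩

theorem transGen_of_eval_alt (k : ℕ) {P Q : RegTerm ι} (a b : A) (h : (alt k P Q).eval R a b) :
    Relation.TransGen (fun a b => P.eval R a b ∨ Q.eval R a b) a b := by
  induction k generalizing P Q a b with
  | zero => exact .single (.inl h)
  | succ k ih =>
    obtain ⟨m, h, h'⟩ := h
    exact .head (.inl h) (Relation.TransGen.mono (fun _ _ => Or.symm) _ _ (ih m b h'))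

end Refl

end RegTerm

namespace RelTerm

variable {ι : Type z} {A : Type w} {R : ι → A → A → Prop}

theorem eval_expand_mono (hR : ∀ s a, R s a a) {k k' : ℕ} (hk : k ≤ k') (p : RelTerm ι) (a b : A)
    (h : (p.expand k).eval R a b) : (p.expand k').eval R a b := by
  induction p generalizing a b with
  | var s => exact h
  | meet P Q ihP ihQ => exact ⟨ihP a b h.1, ihQ a b h.2⟩
  | comp P Q ihP ihQ =>
    obtain ⟨m, h, h'⟩ := h
    exact ⟨m, ihP a m h, ihQ m b h'⟩
  | join P Q ihP ihQ => exact RegTerm.eval_alt_mono hR hk ihP ihQ a b h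

/-- Reflexivity lets products be padded with trivial steps, so the finitely many exponents needed
can be raised to a common one. -/
theorem eval_iff_exists_expand (hR : ∀ s a, R s a a) (p : RelTerm ι) (a b : A) :
    p.eval R a b ↔ ∃ k, (p.expand k).eval R a b := by
  induction p generalizing a b with
  | var s => exact ⟨fun h => ⟨0, h⟩, fun ⟨_, h⟩ => h⟩
  | meet P Q ihP ihQ =>
    simp only [eval, ihP, ihQ]
    constructor
    · rintro ⟨⟨k, h⟩, l, h'⟩
      exact ⟨max k l, eval_expand_mono hR (le_max_left k l) P a b h,
        eval_expand_mono hR (le_max_right k l) Q a b h'⟩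
    · rintro ⟨k, h, h'⟩
      exact ⟨⟨k, h⟩, k, h'⟩
  | comp P Q ihP ihQ =>
    simp only [eval, Relation.Comp, ihP, ihQ]
    constructor
    · rintro ⟨m, ⟨k, h⟩, l, h'⟩
      exact ⟨max k l, m, eval_expand_mono hR (le_max_left k l) P a m h,
        eval_expand_mono hR (le_max_right k l) Q m b h'⟩
    · rintro ⟨k, m, h, h'⟩
      exact ⟨m, ⟨k, h⟩, k, h'⟩
  | join P Q ihP ihQ =>
    simp only [eval, ihP, ihQ, ← exists_or]
    constructor
    · intro h
      induction h using Relation.TransGen.head_induction_on with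
      | single h =>
        obtain ⟨k, h⟩ := h
        refine ⟨k + 1, ?_⟩
        rcases h with h | h
        · exact ⟨b, eval_expand_mono hR k.le_succ P _ b h, RegTerm.eval_refl hR _ b⟩
        · exact RegTerm.eval_alt_mono hR (k := 1) (by omega) (fun _ _ h => h)
            (eval_expand_mono hR k.le_succ Q) _ _ ⟨_, RegTerm.eval_refl hR _ _, h⟩
      | @head a m h _ ih =>
        obtain ⟨k, h⟩ := h
        obtain ⟨l, h'⟩ := ih
        -- Two extra factors P ∘ Q absorb the new step, whichever of the two it uses, and leave a
        -- tail that again begins with P.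
        have tail : (RegTerm.alt (k + l) (P.expand (k + l + 2)) (Q.expand (k + l + 2))).eval R m b :=
          RegTerm.eval_alt_mono hR (by omega) (eval_expand_mono hR (by omega) P)
            (eval_expand_mono hR (by omega) Q) m b h'
        refine ⟨k + l + 2, ?_⟩
        rcases h with h | h
        · exact ⟨m, eval_expand_mono hR (by omega) P a m h, m, RegTerm.eval_refl hR _ m, tail⟩
        · exact ⟨a, RegTerm.eval_refl hR _ a, m, eval_expand_mono hR (by omega) Q a m h, tail⟩
    · rintro ⟨k, h⟩
      exact Relation.TransGen.mono (fun _ _ h => ⟨k, h⟩) _ _ (RegTerm.transGen_of_eval_alt k a b h)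

end RelTerm
open FirstOrder FirstOrder.Language

/-! ### Congruences, quotients and term algebras -/

section Algebra

variable {L : FirstOrder.Language.{u, v}} {A : Type w} [L.Structure A]

theorem IsCongruence.realize {r : Setoid A} (hr : IsCongruence L r) {X : Type x} (t : L.Term X)
    {a b : X → A} (h : ∀ i, r (a i) (b i)) : r (t.realize a) (t.realize b) := by
  induction t with
  | var i => exact h i
  | func f ts ih => exact hr _ f _ _ ih

/-- An equivalence relation preserved by the operations in each argument separately is a
congruence. -/
theorem isCongruence_of_update {r : Setoid A}
    (h : ∀ (n : ℕ) (f : L.Functions n) (a : Fin n → A) (i : Fin n) (b : A), r (a i) b →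
      r (Structure.funMap f a) (Structure.funMap f (Function.update a i b))) :
    IsCongruence L r := by
  intro n f a b hab
  have key : ∀ S : Finset (Fin n), r (Structure.funMap f a) (Structure.funMap f (S.piecewise b a)) := by
    intro S
    induction S using Finset.induction_on with
    | empty => simp
    | insert i S hi ih =>
      rw [Finset.piecewise_insert]
      refine r.trans ih (h n f _ i _ ?_)
      rw [Finset.piecewise_eq_of_notMem _ _ _ hi]
      exact hab i
  simpa using key Finset.univ

variable (L) in
theorem isCongruence_bot : IsCongruence L (⊥ : Setoid A) := by
  intro n f a b h
  obtain rfl : a = b := funext h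
  rfl

variable (L) in
theorem tcCommutator_bot : tcCommutator L (⊥ : Setoid A) ⊥ = ⊥ := by
  refine le_bot_iff.1 (sInf_le ⟨isCongruence_bot L, ?_⟩)
  intro n m f a b c d _ hcd _
  obtain rfl : c = d := funext hcd
  rfl

theorem tcCommutator_le {α β δ : Setoid A} (h : IsCongruence L δ) (h' : Centralizes L α β δ) :
    tcCommutator L α β ≤ δ :=
  sInf_le ⟨h, h'⟩

variable (L) in
theorem isCongruence_tcCommutator (α β : Setoid A) : IsCongruence L (tcCommutator L α β) :=
  fun n f a b h δ hδ => hδ.1 n f a b fun i => h i δ hδ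

variable (L) in
theorem centralizes_tcCommutator (α β : Setoid A) : Centralizes L α β (tcCommutator L α β) :=
  fun n m f a b c d ha hc h δ hδ => hδ.2 n m f a b c d ha hc (h δ hδ)

theorem IsAbelian.cancel (hA : IsAbelian L A) {I J : Type x} (t : L.Term (I ⊕ J)) (a b : I → A)
    (c d : J → A) (h : t.realize (Sum.elim a c) = t.realize (Sum.elim a d)) :
    t.realize (Sum.elim b c) = t.realize (Sum.elim b d) := by
  classical
  let S := t.varFinset
  let ε : S ≃ Fin S.card := S.equivFin
  let f : S → A ⊕ (Fin S.card ⊕ Fin S.card) := fun v =>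
    Sum.inr (v.1.elim (fun _ => Sum.inl (ε v)) fun _ => Sum.inr (ε v))
  have key : ∀ (a : I → A) (c : J → A) (a' : Fin S.card → A) (c' : Fin S.card → A),
      (∀ v i, v.1 = Sum.inl i → a' (ε v) = a i) → (∀ v j, v.1 = Sum.inr j → c' (ε v) = c j) →
      polyEval L (t.restrictVar f) a' c' = t.realize (Sum.elim a c) := by
    intro a c a' c' ha hc
    refine Term.realize_restrictVar _ (fun v => ?_)
    rcases hv : v.1 with i | j
    · simp [f, hv, ha v i hv]
    · simp [f, hv, hc v j hv]
  -- Both blocks are indexed by all variables of t; the entries belonging to the other side are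
  -- fillers that are never read.
  have := hA _ _ (t.restrictVar f) (fun k => (ε.symm k).1.elim a c) (fun k => (ε.symm k).1.elim b c)
    (fun k => (ε.symm k).1.elim a c) (fun k => (ε.symm k).1.elim a d) (fun _ => trivial)
    (fun _ => trivial) ?_
  · change _ = _ at this
    rwa [key b c, key b d] at this <;> intro v i hi <;> simp [hi]
  · change _ = _
    rwa [key a c, key a d] <;> intro v i hi <;> simp [hi]

variable (L) in
/-- The `2 × 2` matrices of the term condition. -/
def TermMat (p q r s : A) : Prop :=
  ∃ t : L.Term ((A × A) ⊕ (A × A)),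
    t.realize (Sum.elim Prod.fst Prod.fst) = p ∧ t.realize (Sum.elim Prod.fst Prod.snd) = q ∧
    t.realize (Sum.elim Prod.snd Prod.fst) = r ∧ t.realize (Sum.elim Prod.snd Prod.snd) = s

/-- Variables are named by the pairs of values they take, so the terms witnessing the different
arguments already share their variables and can be composed directly. -/
theorem TermMat.funMap {n : ℕ} (f : L.Functions n) {p q r s : Fin n → A}
    (h : ∀ i, TermMat L (p i) (q i) (r i) (s i)) :
    TermMat L (Structure.funMap f p) (Structure.funMap f q) (Structure.funMap f r)
      (Structure.funMap f s) := by
  choose t h₁ h₂ h₃ h₄ using h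
  exact ⟨.func f t, by simp [h₁], by simp [h₂], by simp [h₃], by simp [h₄]⟩

theorem IsAbelian.termCondition (hA : IsAbelian L A) : TermCondition (TermMat L (A := A)) where
  row a b := ⟨.var (.inl (a, b)), by simp⟩
  col c d := ⟨.var (.inr (c, d)), by simp⟩
  cancel := by
    rintro _ _ _ _ h ⟨t, rfl, rfl, rfl, rfl⟩
    exact hA.cancel t _ _ _ _ h

end Algebra

/-- The quotient of an algebra by an equivalence relation, with the operations computed at
representatives. -/
def QuotAlg (L : FirstOrder.Language.{u, v}) {A : Type w} [L.Structure A] (r : Setoid A) : Type w :=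
  Quotient r

namespace QuotAlg

variable {L : FirstOrder.Language.{u, v}} {A : Type w} [L.Structure A] {r : Setoid A}

variable (L r) in
/-- The class of an element. -/
def mk (a : A) : QuotAlg L r := Quotient.mk r a

/-- A representative of a class. -/
noncomputable def out (a : QuotAlg L r) : A := Quotient.out (s := r) a

@[simp]
theorem mk_out (a : QuotAlg L r) : mk L r a.out = a := Quotient.out_eq (s := r) a

theorem mk_eq_mk {a b : A} : mk L r a = mk L r b ↔ r a b := Quotient.eq

theorem out_mk (a : A) : r (mk L r a).out a := mk_eq_mk.1 (mk_out _)

noncomputable instance : L.Structure (QuotAlg L r) where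
  funMap f a := mk L r (Structure.funMap f fun i => (a i).out)
  RelMap _ _ := False

theorem funMap_def {n : ℕ} (f : L.Functions n) (a : Fin n → QuotAlg L r) :
    Structure.funMap f a = mk L r (Structure.funMap f fun i => (a i).out) := rfl

theorem realize_mk (hr : IsCongruence L r) {X : Type x} (t : L.Term X) (a : X → A) :
    t.realize (fun i => mk L r (a i)) = mk L r (t.realize a) := by
  induction t with
  | var i => rfl
  | func f ts ih =>
    simp only [Term.realize_func, ih, funMap_def, mk_eq_mk]
    exact hr _ f _ _ fun i => out_mk _

theorem realize_eq (hr : IsCongruence L r) {X : Type x} (t : L.Term X) (a : X → QuotAlg L r) :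
    t.realize a = mk L r (t.realize fun i => (a i).out) := by
  simp [← realize_mk hr]

end QuotAlg

/-- The algebra of terms with variables in `X`. -/
def TermAlg (L : FirstOrder.Language.{u, v}) (X : Type) : Type (max u w) := ULift.{w, u} (L.Term X)

namespace TermAlg

variable {L : FirstOrder.Language.{u, v}} {X : Type}

/-- A term, as an element of the term algebra. -/
def of (t : L.Term X) : TermAlg.{u, v, w} L X := ULift.up t

/-- An element of the term algebra, as a term. -/
def term (t : TermAlg.{u, v, w} L X) : L.Term X := ULift.down t

@[simp]
theorem term_of (t : L.Term X) : (of.{u, v, w} t).term = t := rfl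

instance : L.Structure (TermAlg.{u, v, w} L X) where
  funMap f a := of (.func f fun i => (a i).term)
  RelMap _ _ := False

theorem funMap_def {n : ℕ} (f : L.Functions n) (a : Fin n → TermAlg.{u, v, w} L X) :
    Structure.funMap f a = of (.func f fun i => (a i).term) := rfl

theorem term_realize {Y : Type x} (t : L.Term Y) (a : Y → TermAlg.{u, v, w} L X) :
    (t.realize a).term = t.subst fun i => (a i).term := by
  induction t with
  | var i => rfl
  | func f ts ih => simp [funMap_def, ih, Term.subst]

end TermAlg

/-! ### Relatively free algebras -/

section Free

variable {L : FirstOrder.Language.{u, v}} (K : ∀ (B : Type (max u w)) [L.Structure B], Prop)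
  (W : Type)

/-- Two terms are identified if they are equal in all algebras of the class `K`. -/
def freeSetoid : Setoid (TermAlg.{u, v, w} L W) where
  r s t := ∀ (B : Type (max u w)) [L.Structure B], K B → ∀ a : W → B,
    s.term.realize a = t.term.realize a
  iseqv :=
    { refl := fun _ _ _ _ _ => rfl
      symm := fun h B _ hB a => (h B hB a).symm
      trans := fun h h' B _ hB a => (h B hB a).trans (h' B hB a) }

theorem isCongruence_freeSetoid : IsCongruence L (freeSetoid.{u, v, w} K W) := by
  intro n f a b h B _ hB e
  simp only [TermAlg.funMap_def, TermAlg.term_of, Term.realize_func]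
  exact congrArg _ (funext fun i => h i B hB e)

/-- The free algebra over `W` with respect to the class `K`. -/
abbrev FreeAlg : Type (max u w) := QuotAlg L (freeSetoid.{u, v, w} K W)

namespace FreeAlg

variable {K W}

variable (K) in
/-- The free generators. -/
def gen (i : W) : FreeAlg.{u, v, w} K W := QuotAlg.mk L _ (TermAlg.of (.var i))

/-- The homomorphism given by the images of the generators. -/
noncomputable def lift {B : Type (max u w)} [L.Structure B] (a : W → B)
    (t : FreeAlg.{u, v, w} K W) : B :=
  t.out.term.realize a

theorem lift_mk {B : Type (max u w)} [L.Structure B] (hB : K B) (a : W → B)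
    (t : TermAlg.{u, v, w} L W) : lift (K := K) a (QuotAlg.mk L _ t) = t.term.realize a :=
  QuotAlg.out_mk (r := freeSetoid K W) t B hB a

theorem ext {s t : FreeAlg.{u, v, w} K W}
    (h : ∀ (B : Type (max u w)) [L.Structure B], K B → ∀ a : W → B, lift a s = lift a t) : s = t := by
  rw [← QuotAlg.mk_out s, ← QuotAlg.mk_out t, QuotAlg.mk_eq_mk]
  exact h

theorem lift_gen {B : Type (max u w)} [L.Structure B] (hB : K B) (a : W → B) (i : W) :
    lift a (gen.{u, v, w} K i) = a i :=
  lift_mk hB a _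

theorem lift_realize {B : Type (max u w)} [L.Structure B] (hB : K B) (a : W → B) {Y : Type x}
    (t : L.Term Y) (e : Y → FreeAlg.{u, v, w} K W) :
    lift a (t.realize e) = t.realize fun i => lift a (e i) := by
  rw [QuotAlg.realize_eq (isCongruence_freeSetoid K W), lift_mk hB, TermAlg.term_realize,
    Term.realize_subst]
  rfl

theorem satisfiesEq {Y : Type x} {s t : L.Term Y}
    (h : ∀ (B : Type (max u w)) [L.Structure B], K B → SatisfiesEq L B s t) :
    SatisfiesEq L (FreeAlg.{u, v, w} K W) s t := by
  intro e
  refine ext fun B _ hB a => ?_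
  rw [lift_realize hB, lift_realize hB]
  exact h B hB _

/-- The term condition is an implication between equations, and homomorphisms into members of `K`
separate points. -/
theorem isAbelian (h : ∀ (B : Type (max u w)) [L.Structure B], K B → IsAbelian L B) :
    IsAbelian L (FreeAlg.{u, v, w} K W) := by
  intro n m f a b c d _ _ hf
  refine ext fun B _ hB e => ?_
  have key : ∀ (a : Fin n → FreeAlg.{u, v, w} K W) (c : Fin m → FreeAlg.{u, v, w} K W),
      lift e (polyEval L f a c) = polyEval L (f.relabel (Sum.map (lift e) id))
        (fun i => lift e (a i)) fun j => lift e (c j) := by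
    intro a c
    rw [polyEval, lift_realize hB, polyEval, Term.realize_relabel]
    congr 1
    funext i
    rcases i with i | i | i <;> rfl
  rw [key, key]
  refine h B hB n m _ (fun i => lift e (a i)) _ _ _ (fun _ => trivial) (fun _ => trivial) ?_
  exact (key a c).symm.trans ((congrArg (lift e) hf).trans (key a d))

end FreeAlg

end Free

/-! ### Idempotent terms -/

theorem update_bool {X : Type x} [DecidableEq X] {B : Type y} (k : X) (f : Bool → B) :
    Function.update (fun _ => f false) k (f true) = fun i => f (decide (i = k)) := by
  funext i
  by_cases hi : i = k <;> simp [hi]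

theorem elim_option {X : Type x} {B : Type y} (f : Option X → B) :
    Sum.elim (fun _ : X => f none) (fun i => f (some i)) =
      fun i => f (Sum.elim (fun _ => none) some i) := by
  funext i
  rcases i with i | i <;> rfl

namespace Variety

variable {L : FirstOrder.Language.{u, v}} (V : Variety L)

/-- The term `t` is idempotent in `V`. -/
def IdemTerm {X : Type x} (t : L.Term X) : Prop :=
  ∀ (A : Type w) [L.Structure A], V.Mem A → ∀ a : A, t.realize (fun _ => a) = a

variable {V}

/-- A term of the idempotent reduct, as a term of `V`. -/
def flat {X : Type x} : (idemLang.{u, v, w} V).Term X → L.Term X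
  | .var i => .var i
  | .func f ts => f.1.subst fun i => flat (ts i)

theorem realize_flat {B : Type w} [L.Structure B] {X : Type x} (t : (idemLang.{u, v, w} V).Term X)
    (a : X → B) :
    (flat t).realize a = @Term.realize (idemLang.{u, v, w} V) B (V.idemStructure B) X a t := by
  induction t with
  | var i => rfl
  | func f ts ih =>
    simp only [flat, Term.realize_subst, ih]
    rfl

/-! ### Values of idempotent terms in abelian algebras of the idempotent reduct -/

section Value

variable {A : Type y} [(idemLang.{u, v, w} V).Structure A]

/-- The identities of the reduct are written in variables from ℕ. Countably many variables embed
there, and nonemptiness supplies values for the unused ones. -/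
theorem realize_eq_of_flat (hA : (idemReduct.{u, v, w} V).Mem A) [Nonempty A] {X : Type x}
    [Countable X] (s t : (idemLang.{u, v, w} V).Term X)
    (h : ∀ (B : Type w) [L.Structure B], V.Mem B → ∀ a : X → B,
      (flat s).realize a = (flat t).realize a) (a : X → A) : s.realize a = t.realize a := by
  obtain ⟨f, hf⟩ := exists_injective_nat X
  have := hA (s.relabel f, t.relabel f) ?_ (Function.extend f a fun _ => Classical.arbitrary A)
  · simpa only [Term.realize_relabel, Function.extend_comp hf] using this
  · intro B _ hB b
    have := h B hB (b ∘ f)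
    simp only [realize_flat] at this
    let _ := V.idemStructure B
    simpa using this

variable {X : Type x} [Finite X] {t t' : L.Term X}

/-- The operation symbol of the idempotent reduct given by an idempotent term. -/
noncomputable def symbol (ht : IdemTerm.{u, v, w} V t) :
    (idemLang.{u, v, w} V).Functions (Nat.card X) :=
  ⟨t.relabel (Finite.equivFin X), fun B _ hB b => by
    rw [Term.realize_relabel]
    exact ht B hB b⟩

/-- The value of an idempotent term in an algebra of the idempotent reduct. -/
noncomputable def value (ht : IdemTerm.{u, v, w} V t) (a : X → A) : A :=
  Structure.funMap (symbol ht) (a ∘ (Finite.equivFin X).symm)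

/-- The term of the idempotent reduct given by an idempotent term and a renaming of variables. -/
noncomputable def symbolTerm (ht : IdemTerm.{u, v, w} V t) {Z : Type z} (r : X → Z) :
    (idemLang.{u, v, w} V).Term Z :=
  .func (symbol ht) fun k => .var (r ((Finite.equivFin X).symm k))

theorem realize_flat_symbolTerm (ht : IdemTerm.{u, v, w} V t) {Z : Type z} (r : X → Z)
    {B : Type w} [L.Structure B] (b : Z → B) :
    (flat (symbolTerm ht r)).realize b = t.realize fun i => b (r i) := by
  simp only [symbolTerm, flat, symbol, Term.realize_subst, Term.realize_relabel, Term.realize_var]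
  congr 1
  funext i
  simp

theorem value_eq_value (hA : (idemReduct.{u, v, w} V).Mem A) [Nonempty A]
    (ht : IdemTerm.{u, v, w} V t) {Y : Type x} [Finite Y] {t' : L.Term Y}
    (ht' : IdemTerm.{u, v, w} V t') {Z : Type z} [Countable Z] (r : X → Z) (r' : Y → Z)
    (h : ∀ (B : Type w) [L.Structure B], V.Mem B → ∀ b : Z → B,
      (t.realize fun i => b (r i)) = t'.realize fun i => b (r' i)) (a : Z → A) :
    (value ht fun i => a (r i)) = value ht' fun i => a (r' i) :=
  realize_eq_of_flat hA (symbolTerm ht r) (symbolTerm ht' r')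
    (fun B _ hB b => by simpa only [realize_flat_symbolTerm] using h B hB b) a

theorem value_eq_apply (hA : (idemReduct.{u, v, w} V).Mem A) (ht : IdemTerm.{u, v, w} V t)
    {Z : Type z} [Countable Z] (r : X → Z) (k : Z)
    (h : ∀ (B : Type w) [L.Structure B], V.Mem B → ∀ b : Z → B,
      (t.realize fun i => b (r i)) = b k) (a : Z → A) : (value ht fun i => a (r i)) = a k := by
  have : Nonempty A := ⟨a k⟩
  exact realize_eq_of_flat hA (symbolTerm ht r) (.var k)
    (fun B _ hB b => (realize_flat_symbolTerm ht r b).trans (h B hB b)) a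

theorem value_const (hA : (idemReduct.{u, v, w} V).Mem A) (ht : IdemTerm.{u, v, w} V t) (a : A) :
    (value ht fun _ => a) = a :=
  value_eq_apply hA ht (fun _ => ()) () (fun B _ hB b => ht B hB (b ())) fun _ => a

theorem value_congr {θ : Setoid A} (hθ : IsCongruence (idemLang.{u, v, w} V) θ)
    (ht : IdemTerm.{u, v, w} V t) {a b : X → A} (h : ∀ i, θ (a i) (b i)) :
    θ (value ht a) (value ht b) :=
  hθ _ _ _ _ fun _ => h _

/-- This is `TermCondition.switch` with the variable k as distinguished argument. -/
theorem value_update (hA : (idemReduct.{u, v, w} V).Mem A)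
    (hab : IsAbelian (idemLang.{u, v, w} V) A) [DecidableEq X] (ht : IdemTerm.{u, v, w} V t)
    (ht' : IdemTerm.{u, v, w} V t') (k : X)
    (h : ∀ (B : Type w) [L.Structure B], V.Mem B → ∀ b o : B,
      t.realize (Function.update (fun _ => o) k b) = t'.realize (Function.update (fun _ => o) k b))
    (a : X → A) (c : A) (heq : value ht a = value ht' a) :
    value ht (Function.update a k c) = value ht' (Function.update a k c) := by
  have : Nonempty A := ⟨c⟩
  have pres : ∀ {t : L.Term X} (ht : IdemTerm.{u, v, w} V t),
      PreservesMat (TermMat (idemLang.{u, v, w} V)) fun (b : A) (a : X → A) =>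
        value ht (Function.update a k b) := by
    intro t ht p q r s p' q' r' s' h h'
    refine TermMat.funMap _ fun i => ?_
    simp only [Function.comp_apply, Function.update_apply]
    split
    · exact h
    · exact h' _
  have idem : ∀ {t : L.Term X} (ht : IdemTerm.{u, v, w} V t) (a : A),
      value ht (Function.update (fun _ => a) k a) = a := by
    intro t ht a
    rw [Function.update_eq_self_iff.2 rfl, value_const hA]
  refine hab.termCondition.switch (pres ht) (pres ht') (idem ht) (idem ht') ?_ (a k) c a ?_
  · intro b o
    have := value_eq_value hA ht' ht (fun i => decide (i = k)) (fun i => decide (i = k))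
      (fun B _ hB f => by rw [← update_bool k f]; exact (h B hB _ _).symm) (fun i => if i then b else o)
    rwa [← update_bool k fun i => if i then b else o] at this
  · simpa using heq

theorem value_change (hA : (idemReduct.{u, v, w} V).Mem A)
    (hab : IsAbelian (idemLang.{u, v, w} V) A) [DecidableEq X] (ht : IdemTerm.{u, v, w} V t)
    (ht' : IdemTerm.{u, v, w} V t') (S : Finset X)
    (h : ∀ k ∈ S, ∀ (B : Type w) [L.Structure B], V.Mem B → ∀ b o : B,
      t.realize (Function.update (fun _ => o) k b) = t'.realize (Function.update (fun _ => o) k b))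
    (a c : X → A) (heq : value ht a = value ht' a) :
    value ht (S.piecewise c a) = value ht' (S.piecewise c a) := by
  induction S using Finset.induction_on with
  | empty => simpa using heq
  | insert k S _ ih =>
    rw [Finset.piecewise_insert]
    exact value_update hA hab ht ht' k (h k (Finset.mem_insert_self k S)) _ _
      (ih fun k hk => h k (Finset.mem_insert_of_mem hk))

/-- The term condition for the values in an abelian algebra of four idempotent terms that fit
together as the entries of a matrix of the term condition do. -/
theorem value_termCondition (hA : (idemReduct.{u, v, w} V).Mem A)
    (hab : IsAbelian (idemLang.{u, v, w} V) A) {W : Type x} [Finite W] {p q r s : L.Term (W ⊕ W)}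
    (hp : IdemTerm.{u, v, w} V p) (hq : IdemTerm.{u, v, w} V q) (hr : IdemTerm.{u, v, w} V r)
    (hs : IdemTerm.{u, v, w} V s)
    (hpq : ∀ (B : Type w) [L.Structure B], V.Mem B → ∀ (b : W → B) (o : B),
      p.realize (Sum.elim b fun _ => o) = q.realize (Sum.elim b fun _ => o))
    (hrs : ∀ (B : Type w) [L.Structure B], V.Mem B → ∀ (b : W → B) (o : B),
      r.realize (Sum.elim b fun _ => o) = s.realize (Sum.elim b fun _ => o))
    (hpr : ∀ (B : Type w) [L.Structure B], V.Mem B → ∀ (o : B) (b : W → B),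
      p.realize (Sum.elim (fun _ => o) b) = r.realize (Sum.elim (fun _ => o) b))
    (hqs : ∀ (B : Type w) [L.Structure B], V.Mem B → ∀ (o : B) (b : W → B),
      q.realize (Sum.elim (fun _ => o) b) = s.realize (Sum.elim (fun _ => o) b))
    (a : W → A) (o : A) (heq : value hp (Sum.elim a a) = value hq (Sum.elim a a)) :
    value hr (Sum.elim a a) = value hs (Sum.elim a a) := by
  classical
  have : Nonempty A := ⟨o⟩
  have := Fintype.ofFinite W
  have upd : ∀ {B : Type w} (k : W) (b o : B),
      Function.update (fun _ => o) (Sum.inl k : W ⊕ W) b =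
        Sum.elim (Function.update (fun _ => o) k b) fun _ => o := by
    intro B k b o
    funext i
    rcases i with i | i <;> simp [Function.update_apply]
  have change : ∀ {t t' : L.Term (W ⊕ W)} (ht : IdemTerm.{u, v, w} V t)
      (ht' : IdemTerm.{u, v, w} V t'),
      (∀ (B : Type w) [L.Structure B], V.Mem B → ∀ (b : W → B) (o : B),
        t.realize (Sum.elim b fun _ => o) = t'.realize (Sum.elim b fun _ => o)) →
      ∀ a c d : W → A, value ht (Sum.elim a d) = value ht' (Sum.elim a d) →
        value ht (Sum.elim c d) = value ht' (Sum.elim c d) := by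
    intro t t' ht ht' h a c d heq
    have := value_change hA hab ht ht' (Finset.univ.map ⟨Sum.inl, Sum.inl_injective⟩)
      (fun k hk B _ hB b o => by
        obtain ⟨k, -, rfl⟩ := Finset.mem_map.1 hk
        simpa only [Function.Embedding.coeFn_mk, upd] using h B hB _ o)
      (Sum.elim a d) (Sum.elim c d) heq
    have e : (Finset.univ.map ⟨Sum.inl, Sum.inl_injective⟩ : Finset (W ⊕ W)).piecewise
        (Sum.elim c d) (Sum.elim a d) = Sum.elim c d := by
      funext i
      rcases i with i | i <;> simp [Finset.piecewise]
    rwa [e] at this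
  have collapse : ∀ {t t' : L.Term (W ⊕ W)} (ht : IdemTerm.{u, v, w} V t)
      (ht' : IdemTerm.{u, v, w} V t'),
      (∀ (B : Type w) [L.Structure B], V.Mem B → ∀ (o : B) (b : W → B),
        t.realize (Sum.elim (fun _ => o) b) = t'.realize (Sum.elim (fun _ => o) b)) →
      value ht (Sum.elim (fun _ => o) a) = value ht' (Sum.elim (fun _ => o) a) := by
    intro t t' ht ht' h
    have := value_eq_value hA ht ht' (Sum.elim (fun _ => none) some)
      (Sum.elim (fun _ => none) some) (fun B _ hB f => by rw [← elim_option]; exact h B hB _ _)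
      (fun i => i.elim o a)
    rwa [← elim_option fun i : Option W => i.elim o a] at this
  -- The left block is made constant, where p coincides with r and q with s; then it is moved back
  -- to a.
  refine change hr hs hrs (fun _ => o) a a ?_
  rw [← collapse hp hr hpr, ← collapse hq hs hqs]
  exact change hp hq hpq a (fun _ => o) a heq

end Value

end Variety

/-! ### From commutator equations to congruence inclusions: the free algebra and its separation
congruence -/

theorem elim_same {X : Type x} {B : Type y} (f : X → B) :
    Sum.elim f f = fun i => f (Sum.elim id id i) := by
  funext i
  rcases i with i | i <;> rfl

namespace Variety

variable {L : FirstOrder.Language.{u, v}} (V : Variety L) (W : Type)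

/-- The free algebra of the variety. -/
abbrev Free : Type (max u w) :=
  FreeAlg.{u, v, w} (L := L) (fun B _ => V.Mem B) W

theorem mem_free : V.Mem (Free.{u, v, w} V W) :=
  fun e he => FreeAlg.satisfiesEq fun _ _ hB => hB e he

/-- The congruence of the free algebra that is generated by identifying all free generators. -/
def collapse : Setoid (Free.{u, v, w} V W) where
  r s t := ∀ (B : Type (max u w)) [L.Structure B], V.Mem B → ∀ b : B,
    FreeAlg.lift (fun _ => b) s = FreeAlg.lift (fun _ => b) t
  iseqv :=
    { refl := fun _ _ _ _ _ => rfl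
      symm := fun h B _ hB b => (h B hB b).symm
      trans := fun h h' B _ hB b => (h B hB b).trans (h' B hB b) }

theorem isCongruence_collapse : IsCongruence L (collapse.{u, v, w} V W) := by
  intro n f s t h B _ hB b
  have key := FreeAlg.lift_realize (K := fun B _ => V.Mem B) (W := W) hB (fun _ => b)
    (.func f .var : L.Term (Fin n))
  refine (key s).trans (Eq.trans ?_ (key t).symm)
  exact congrArg _ (funext fun i => h i B hB b)

variable {V W}

/-- An element of the free algebra is idempotent if the corresponding term is. -/
def IdemElt (t : Free.{u, v, w} V W) : Prop := IdemTerm.{u, v, max u w} V t.out.term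

/-- Idempotence concerns only the value at constant assignments, which is what `collapse` records.
-/
theorem IdemElt.of_collapse {s t : Free.{u, v, w} V W} (hs : IdemElt s) (h : collapse V W s t) :
    IdemElt t :=
  fun B _ hB b => (h B hB b).symm.trans (hs B hB b)

/-- The value at `t` of the unary polynomial operation given by `g`. -/
noncomputable def polyAt (g : L.Term (Free.{u, v, w} V W ⊕ Unit)) (t : Free.{u, v, w} V W) :
    Free.{u, v, w} V W :=
  g.realize (Sum.elim id fun _ => t)

theorem polyAt_collapse (g : L.Term (Free.{u, v, w} V W ⊕ Unit)) {s t : Free.{u, v, w} V W}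
    (h : collapse V W s t) : collapse V W (polyAt g s) (polyAt g t) :=
  (isCongruence_collapse V W).realize g fun
    | .inl _ => (collapse V W).refl _
    | .inr _ => h

section Separation

variable {A : Type y} [(idemLang.{u, v, max u w} V).Structure A] [Finite W] (a : W → A)

/-- The largest congruence below `collapse` that does not identify idempotent elements with
different values at `a`. -/
def separation : Setoid (Free.{u, v, w} V W) where
  r s t := collapse V W s t ∧ ∀ (g : L.Term (Free.{u, v, w} V W ⊕ Unit))
    (h : IdemElt (polyAt g s)) (h' : IdemElt (polyAt g t)), value h a = value h' a
  iseqv :=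
    { refl := fun _ => ⟨(collapse V W).refl _, fun _ _ _ => rfl⟩
      symm := fun h => ⟨(collapse V W).symm h.1, fun g i j => (h.2 g j i).symm⟩
      -- The middle element has a value because idempotence passes along `collapse`; this is why
      -- that congruence is part of the definition.
      trans := fun h h' => ⟨(collapse V W).trans h.1 h'.1, fun g i j =>
        (h.2 g i (i.of_collapse (polyAt_collapse g h.1))).trans (h'.2 g _ j)⟩ }

/-- A unary polynomial applied to a basic operation with all but one argument fixed is again a unary
polynomial. -/
theorem isCongruence_separation : IsCongruence L (separation.{u, v, w} (V := V) a) := by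
  refine isCongruence_of_update fun n f s i t h => ⟨?_, fun g => ?_⟩
  · refine isCongruence_collapse V W n f _ _ fun j => ?_
    by_cases hj : j = i
    · subst hj
      simpa using h.1
    · simp [hj]
  · let g' : L.Term (Free.{u, v, w} V W ⊕ Unit) := g.subst (Sum.elim (fun c => .var (.inl c))
      fun _ => .func f fun j => if j = i then .var (.inr ()) else .var (.inl (s j)))
    have key : ∀ t, polyAt g' t = polyAt g (Structure.funMap f (Function.update s i t)) := by
      intro t
      simp only [polyAt, g', Term.realize_subst]
      congr 1
      funext j
      rcases j with j | j
      · rfl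
      · simp only [Sum.elim_inr, Term.realize_func]
        congr 1
        funext j
        by_cases hj : j = i
        · subst hj
          simp
        · simp [hj]
    have e := h.2 g'
    rw [key, key, Function.update_eq_self] at e
    exact e

variable [Nonempty A]

theorem centralizes_separation (hA : (idemReduct.{u, v, max u w} V).Mem A)
    (hab : IsAbelian (idemLang.{u, v, max u w} V) A) :
    Centralizes L (collapse.{u, v, w} V W) (collapse V W) (separation a) := by
  intro n m f s t c d hst hcd h
  have poly : ∀ {s t : Fin n → Free.{u, v, w} V W} {c d : Fin m → Free.{u, v, w} V W},
      (∀ i, collapse V W (s i) (t i)) → (∀ j, collapse V W (c j) (d j)) →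
      collapse V W (polyEval L f s c) (polyEval L f t d) := by
    intro s t c d hst hcd
    refine (isCongruence_collapse V W).realize f fun i => ?_
    rcases i with i | i | j
    · exact (collapse V W).refl _
    · exact hst i
    · exact hcd j
  have rfl' : ∀ {k : ℕ} (e : Fin k → Free.{u, v, w} V W) (i), collapse V W (e i) (e i) :=
    fun _ _ => (collapse V W).refl _
  refine ⟨poly (rfl' t) hcd, fun g htc htd => ?_⟩
  let T : L.Term (Free.{u, v, w} V W ⊕ (Fin n ⊕ Fin m)) :=
    g.subst (Sum.elim (fun k => .var (.inl k)) fun _ => f)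
  -- The generators are doubled: those in the first block of arguments go to the left copy, those in
  -- the second block and in the constants to the right copy. Making one copy constant erases the
  -- difference between arguments of that block that are related by `collapse`.
  let H (s : Fin n → Free.{u, v, w} V W) (c : Fin m → Free.{u, v, w} V W) : L.Term (W ⊕ W) :=
    T.subst (Sum.elim (fun k => k.out.term.relabel .inr)
      (Sum.elim (fun i => (s i).out.term.relabel .inl) fun j => (c j).out.term.relabel .inr))
  have realize_H : ∀ (s c) {B : Type (max u w)} [L.Structure B] (b b' : W → B),
      (H s c).realize (Sum.elim b b') = T.realize (Sum.elim (FreeAlg.lift b')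
        (Sum.elim (fun i => FreeAlg.lift b (s i)) fun j => FreeAlg.lift b' (c j))) := by
    intro s c B _ b b'
    simp only [H, Term.realize_subst]
    congr 1
    funext i
    rcases i with i | i | j <;> simp [FreeAlg.lift]
  have lift_T : ∀ (s c) {B : Type (max u w)} [L.Structure B], V.Mem B → ∀ b : W → B,
      FreeAlg.lift b (polyAt g (polyEval L f s c)) = (H s c).realize (Sum.elim b b) := by
    intro s c B _ hB b
    have : polyAt g (polyEval L f s c) = T.realize (Sum.elim id (Sum.elim s c)) := by
      simp only [polyAt, polyEval, T, Term.realize_subst]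
      congr 1
      funext i
      rcases i with i | i <;> rfl
    rw [this, FreeAlg.lift_realize hB, realize_H]
    congr 1
    funext i
    rcases i with i | i | j <;> rfl
  have idem_H : ∀ {s c}, IdemElt (polyAt g (polyEval L f s c)) →
      IdemTerm.{u, v, max u w} V (H s c) := by
    intro s c h B _ hB b
    have := (lift_T s c hB fun _ => b).symm.trans (h B hB b)
    rwa [Sum.elim_lam_const_lam_const] at this
  have value_H : ∀ {s c} (h : IdemElt (polyAt g (polyEval L f s c))),
      value h a = value (idem_H h) (Sum.elim a a) := by
    intro s c h
    rw [elim_same a]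
    exact value_eq_value hA h (idem_H h) id (Sum.elim id id)
      (fun B _ hB b => (lift_T s c hB b).trans (by rw [elim_same b])) a
  have hsc : IdemElt (polyAt g (polyEval L f s c)) :=
    htc.of_collapse (polyAt_collapse g (poly (fun i => (collapse V W).symm (hst i)) (rfl' c)))
  have hsd : IdemElt (polyAt g (polyEval L f s d)) :=
    htd.of_collapse (polyAt_collapse g (poly (fun i => (collapse V W).symm (hst i)) (rfl' d)))
  have := h.2 g hsc hsd
  rw [value_H, value_H] at this ⊢
  refine value_termCondition hA hab (idem_H hsc) (idem_H hsd) (idem_H htc) (idem_H htd)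
    ?_ ?_ ?_ ?_ a (Classical.arbitrary A) this
  · intro B _ hB b o
    rw [realize_H, realize_H, funext fun j => hcd j B hB o]
  · intro B _ hB b o
    rw [realize_H, realize_H, funext fun j => hcd j B hB o]
  · intro B _ hB o b
    rw [realize_H, realize_H, funext fun i => hst i B hB o]
  · intro B _ hB o b
    rw [realize_H, realize_H, funext fun i => hst i B hB o]

/-- A commutator equation between idempotent terms that holds in `V` holds as an equation in the
abelian algebras of the idempotent reduct. -/
theorem value_eq_of_satisfiesCommEq (hA : (idemReduct.{u, v, max u w} V).Mem A)
    (hab : IsAbelian (idemLang.{u, v, max u w} V) A) {s t : L.Term W} (hs : IdemTerm.{u, v, max u w} V s)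
    (ht : IdemTerm.{u, v, max u w} V t)
    (h : ∀ (B : Type (max u w)) [L.Structure B], V.Mem B → SatisfiesCommEq L B s t) :
    value hs a = value ht a := by
  have gen_collapse : ∀ i j : W, collapse.{u, v, w} V W (FreeAlg.gen _ i) (FreeAlg.gen _ j) := by
    intro i j B _ hB b
    rw [FreeAlg.lift_gen hB, FreeAlg.lift_gen hB]
  have hst := tcCommutator_le (isCongruence_separation.{u, v, w} a)
    (centralizes_separation.{u, v, w} a hA hab)
    (h _ (mem_free.{u, v, w} V W) _ (isCongruence_collapse V W) _ gen_collapse)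
  have key : ∀ {t : L.Term W}, IdemTerm.{u, v, max u w} V t →
      ∃ h : IdemElt (polyAt (.var (.inr ()))
        (t.realize (FreeAlg.gen.{u, v, w} (L := L) (fun B _ => V.Mem B)))),
        ∀ ht : IdemTerm.{u, v, max u w} V t, value h a = value ht a := by
    intro t ht
    have lift_t : ∀ {B : Type (max u w)} [L.Structure B], V.Mem B → ∀ b : W → B,
        FreeAlg.lift b (t.realize (FreeAlg.gen.{u, v, w} (L := L) (fun B _ => V.Mem B))) =
          t.realize b := by
      intro B _ hB b
      rw [FreeAlg.lift_realize hB]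
      congr 1
      exact funext (FreeAlg.lift_gen hB b)
    refine ⟨fun B _ hB b => (lift_t hB _).trans (ht B hB b), fun ht => ?_⟩
    exact value_eq_value hA _ ht id id (fun B _ hB b => lift_t hB b) a
  obtain ⟨is, vs⟩ := key hs
  obtain ⟨it, vt⟩ := key ht
  rw [← vs hs, ← vt ht]
  exact hst.2 (.var (.inr ())) is it

end Separation

/-- The terms that satisfy the commutator equations of a congruence inclusion are idempotent. -/
theorem idemTerm_of_commEqs {ι : Type z} {p q : RegTerm ι} {t : q.Vertex → L.Term p.Vertex}
    (ht : t q.source = .var p.source)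
    (h : ∀ e ∈ commEqs p q t, ∀ (A : Type w) [L.Structure A], V.Mem A → SatisfiesCommEq L A e.1 e.2)
    (i : q.Vertex) : IdemTerm.{u, v, w} V (t i) := by
  intro B _ hB b
  have key := RegTerm.constant_of_edge q (fun i => (t i).realize fun _ => b) ?_ i
  · simpa [ht] using key
  · intro s c d hcd
    obtain ⟨σ, hσ⟩ := RegTerm.exists_isTransversal p s
    -- At the trivial congruence the commutator is equality, and a transversal does not affect a
    -- constant assignment.
    have := h _ ⟨s, c, d, σ, hcd, hσ, rfl⟩ B hB ⊥ (isCongruence_bot L) (fun _ => b) fun _ _ => rfl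
    rw [tcCommutator_bot, Term.realize_relabel, Term.realize_relabel] at this
    exact this

theorem satisfiesIncl_of_satisfiesCommEqs {ι : Type z} {p q : RelTerm ι}
    (h : SatisfiesCommEqs.{u, v, max u w, z} V p q) (A : Type y)
    [(idemLang.{u, v, max u w} V).Structure A] (hA : (idemReduct.{u, v, max u w} V).Mem A)
    (hab : IsAbelian (idemLang.{u, v, max u w} V) A) :
    SatisfiesIncl (idemLang.{u, v, max u w} V) A p q := by
  intro θ hθ a b hp
  have hR : ∀ s a, θ s a a := fun s => (θ s).refl
  rw [RelTerm.eval_iff_exists_expand hR] at hp ⊢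
  obtain ⟨l, hp⟩ := hp
  obtain ⟨k, t, hsource, htarget, ht⟩ := h l
  obtain ⟨e, he⟩ := (RegTerm.eval_iff_exists_inner _ _ a b).1 hp
  have : Nonempty A := ⟨a⟩
  have idem := idemTerm_of_commEqs hsource ht
  let φ := RegTerm.place a b e
  let ψ : (q.expand k).Vertex → A := fun i => value (idem i) φ
  have hφ : ∀ s c d, Relation.EqvGen ((p.expand l).Edge s) c d → θ s (φ c) (φ d) := by
    intro s c d h
    induction h with
    | rel c d h => exact he s _ _ (RegTerm.hasEdge_place h)
    | refl c => exact (θ s).refl _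
    | symm c d _ ih => exact (θ s).symm ih
    | trans c d e _ _ ih ih' => exact (θ s).trans ih ih'
  have hψ : ∀ s c d, (q.expand k).Edge s c d → θ s (ψ c) (ψ d) := by
    intro s c d h
    obtain ⟨σ, hσ⟩ := RegTerm.exists_isTransversal (p.expand l) s
    have idem' : ∀ i, IdemTerm.{u, v, max u w} V ((t i).relabel σ) := by
      intro i B _ hB b
      rw [Term.realize_relabel]
      exact idem i B hB b
    -- Along an edge labelled s, the path runs from ψ c to its value after applying σ, across by the
    -- commutator equation, and back to ψ d.
    have move : ∀ i, θ s (ψ i) (value (idem' i) φ) := by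
      intro i
      have : value (idem' i) φ = value (idem i) fun j => φ (σ j) :=
        value_eq_value hA (idem' i) (idem i) id σ
          (fun B _ hB b => by rw [Term.realize_relabel]; rfl) φ
      rw [this]
      exact value_congr (hθ s) (idem i) fun j => hφ s _ _ (hσ.1 j)
    have eq : value (idem' c) φ = value (idem' d) φ :=
      value_eq_of_satisfiesCommEq.{u, v, w} φ hA hab (idem' c) (idem' d)
        fun B _ hB => ht _ ⟨s, c, d, σ, h, hσ, rfl⟩ B hB
    exact (θ s).trans (move c) (eq ▸ (θ s).symm (move d))
  have ends : ∀ i j, t i = .var j → ψ i = φ j := fun i j h =>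
    value_eq_apply hA (idem i) id j (fun B _ hB b => by rw [h]; rfl) φ
  refine ⟨k, (RegTerm.eval_iff_exists_inner _ _ a b).2 ⟨fun i => ψ (.inr i), ?_⟩⟩
  have source : ψ (q.expand k).source = a := ends _ _ hsource
  have target : ψ (q.expand k).target = b := ends _ _ htarget
  intro s c d h
  rw [← source, ← target] at h
  obtain ⟨c', d', h', rfl, rfl⟩ :=
    (RegTerm.hasEdge_map ψ (q.expand k) (RegTerm.source _) (RegTerm.target _) Sum.inr s c d).1 h
  exact hψ s _ _ h'

end Variety

/-! ### From congruence inclusions to commutator equations: congruence classes modulo the commutator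
-/

namespace Variety

variable {L : FirstOrder.Language.{u, v}} {V : Variety L}

/-- A congruence class of a member of the variety, as an algebra of the idempotent reduct. -/
@[reducible]
def classStructure {B : Type w} [L.Structure B] (hB : V.Mem B) {θ : Setoid B}
    (hθ : IsCongruence L θ) (b : B) : (idemLang.{u, v, w} V).Structure {c // θ b c} where
  funMap f a := ⟨f.1.realize fun i => (a i).1, by
    -- Idempotence sends the constant tuple b to b, so the class of b is closed.
    have := hθ.realize f.1 fun i => (a i).2
    rwa [f.2 B hB b] at this⟩
  RelMap r := r.elim

theorem val_realize {B : Type w} [L.Structure B] (hB : V.Mem B) {θ : Setoid B}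
    (hθ : IsCongruence L θ) (b : B) {X : Type x} (t : (idemLang.{u, v, w} V).Term X)
    (e : X → {c // θ b c}) :
    letI := classStructure hB hθ b
    (t.realize e).1 = (flat t).realize fun i => (e i).1 := by
  let _ := classStructure hB hθ b
  induction t with
  | var i => rfl
  | func f ts ih =>
    simp only [flat, Term.realize_subst, ← ih]
    rfl

/-- The quotient of a congruence class by the commutator is an abelian algebra of the idempotent
reduct. -/
theorem exists_abelian_quotient {B : Type w} [L.Structure B] (hB : V.Mem B) {θ : Setoid B}
    (hθ : IsCongruence L θ) {W : Type x} [Nonempty W] (a : W → B) (ha : ∀ i j, θ (a i) (a j)) :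
    ∃ (D : Type w) (_ : (idemLang.{u, v, w} V).Structure D), (idemReduct.{u, v, w} V).Mem D ∧
      IsAbelian (idemLang.{u, v, w} V) D ∧ ∃ d : W → D, (∀ i j, a i = a j → d i = d j) ∧
        ∀ s t : (idemLang.{u, v, w} V).Term W, s.realize d = t.realize d →
          tcCommutator L θ θ ((flat s).realize a) ((flat t).realize a) := by
  let b := a (Classical.arbitrary W)
  let _ := classStructure hB hθ b
  let δ : Setoid {c // θ b c} := (tcCommutator L θ θ).comap Subtype.val
  have hδ : IsCongruence (idemLang.{u, v, w} V) δ :=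
    fun n f e e' h => (isCongruence_tcCommutator L θ θ).realize f.1 h
  refine ⟨QuotAlg (idemLang.{u, v, w} V) δ, inferInstance, ?_, ?_,
    fun i => QuotAlg.mk _ δ ⟨a i, ha _ i⟩, ?_, ?_⟩
  · intro e he c
    rw [QuotAlg.realize_eq hδ, QuotAlg.realize_eq hδ]
    refine congrArg _ (Subtype.ext ?_)
    rw [val_realize hB hθ b, val_realize hB hθ b, realize_flat, realize_flat]
    exact he B hB _
  · intro n m f s t c d _ _ h
    have key : ∀ (s : Fin n → QuotAlg (idemLang.{u, v, w} V) δ)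
        (c d : Fin m → QuotAlg (idemLang.{u, v, w} V) δ),
        polyEval _ f s c = polyEval _ f s d ↔ tcCommutator L θ θ
          (polyEval L ((flat f).relabel (Sum.map (fun k => k.out.1) id)) (fun i => (s i).out.1)
            fun j => (c j).out.1)
          (polyEval L ((flat f).relabel (Sum.map (fun k => k.out.1) id)) (fun i => (s i).out.1)
            fun j => (d j).out.1) := by
      intro s c d
      have e : ∀ c : Fin m → QuotAlg (idemLang.{u, v, w} V) δ,
          (f.realize fun i => (Sum.elim id (Sum.elim s c) i : QuotAlg _ δ).out).1 =
          polyEval L ((flat f).relabel (Sum.map (fun k => k.out.1) id)) (fun i => (s i).out.1)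
            fun j => (c j).out.1 := by
        intro c
        rw [val_realize hB hθ b, polyEval, Term.realize_relabel]
        congr 1
        funext i
        rcases i with i | i | i <;> rfl
      rw [← e, ← e, polyEval, polyEval, QuotAlg.realize_eq hδ, QuotAlg.realize_eq hδ,
        QuotAlg.mk_eq_mk]
      rfl
    -- All representatives lie in one θ-class, so C(θ, θ; [θ, θ]) in B applies to them.
    refine (key t c d).2 (centralizes_tcCommutator L θ θ n m _ _ _ _ _ ?_ ?_ ((key s c d).1 h))
    · exact fun i => θ.trans (θ.symm (s i).out.2) (t i).out.2
    · exact fun i => θ.trans (θ.symm (c i).out.2) (d i).out.2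
  · intro i j h
    simp only [h]
  · intro s t h
    rw [QuotAlg.realize_mk hδ, QuotAlg.realize_mk hδ, QuotAlg.mk_eq_mk] at h
    have h : tcCommutator L θ θ _ _ := h
    rwa [val_realize hB hθ b, val_realize hB hθ b] at h

variable (V) in
/-- The free algebra over the vertices of the graph of `p` in the class of abelian algebras of the
idempotent reduct. -/
abbrev VertexAlg {ι : Type z} (p : RegTerm ι) : Type (max u w) :=
  FreeAlg.{u, 0, w} (L := idemLang.{u, v, max u w} V)
    (fun B _ => (idemReduct.{u, v, max u w} V).Mem B ∧ IsAbelian (idemLang.{u, v, max u w} V) B)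
    p.Vertex

/-- The congruence of `VertexAlg` that is generated by the edges with label `X_s`. -/
def edgeCongruence {ι : Type z} (p : RegTerm ι) (s : ι) :
    Setoid (VertexAlg.{u, v, w, z} V p) where
  r c d := ∀ (B : Type (max u w)) [(idemLang.{u, v, max u w} V).Structure B],
    (idemReduct.{u, v, max u w} V).Mem B → IsAbelian (idemLang.{u, v, max u w} V) B →
    ∀ b : p.Vertex → B, (∀ i j, p.Edge s i j → b i = b j) → FreeAlg.lift b c = FreeAlg.lift b d
  iseqv :=
    { refl := fun _ _ _ _ _ _ _ => rfl
      symm := fun h B _ hB hB' b hb => (h B hB hB' b hb).symm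
      trans := fun h h' B _ hB hB' b hb => (h B hB hB' b hb).trans (h' B hB hB' b hb) }

theorem isCongruence_edgeCongruence {ι : Type z} (p : RegTerm ι) (s : ι) :
    IsCongruence (idemLang.{u, v, max u w} V) (edgeCongruence.{u, v, w, z} (V := V) p s) := by
  intro n f c d h B _ hB hB' b hb
  have key := FreeAlg.lift_realize (W := p.Vertex)
    (K := fun B _ => (idemReduct.{u, v, max u w} V).Mem B ∧ IsAbelian (idemLang.{u, v, max u w} V) B)
    ⟨hB, hB'⟩ b (.func f .var : (idemLang.{u, v, max u w} V).Term (Fin n))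
  refine (key c).trans (Eq.trans ?_ (key d).symm)
  exact congrArg _ (funext fun i => h i B hB hB' b hb)

theorem satisfiesCommEqs_of_satisfiesIncl {ι : Type z} {p q : RelTerm ι}
    (h : ∀ (A : Type (max u w)) [(idemLang.{u, v, max u w} V).Structure A],
      (idemReduct.{u, v, max u w} V).Mem A → IsAbelian (idemLang.{u, v, max u w} V) A →
      SatisfiesIncl (idemLang.{u, v, max u w} V) A p q) :
    SatisfiesCommEqs.{u, v, max u w, z} V p q := by
  intro l
  let P := p.expand l
  let θ : ι → Setoid (VertexAlg.{u, v, w, z} V P) := edgeCongruence P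
  let g : P.Vertex → VertexAlg.{u, v, w, z} V P := FreeAlg.gen _
  have hR : ∀ s a, θ s a a := fun s => (θ s).refl
  have hp : p.eval (fun s => (θ s).r) (g P.source) (g P.target) := by
    refine (RelTerm.eval_iff_exists_expand hR p _ _).2
      ⟨l, (RegTerm.eval_iff_exists_inner _ _ _ _).2 ⟨fun i => g (.inr i), ?_⟩⟩
    intro s c d hcd
    obtain ⟨c, d, hcd', rfl, rfl⟩ := (RegTerm.hasEdge_map g P P.source P.target Sum.inr s c d).1 hcd
    intro B _ hB hB' b hb
    rw [FreeAlg.lift_gen ⟨hB, hB'⟩, FreeAlg.lift_gen ⟨hB, hB'⟩]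
    exact hb c d hcd'
  have hq := h (VertexAlg.{u, v, w, z} V P)
    (fun e he => FreeAlg.satisfiesEq fun _ _ hB => hB.1 e he) (FreeAlg.isAbelian fun _ _ hB => hB.2)
    θ (isCongruence_edgeCongruence P) _ _ hp
  -- The free algebra depends on l only, so one witness for `q` in it fixes k for all members of the
  -- variety.
  obtain ⟨k, hq⟩ := (RelTerm.eval_iff_exists_expand hR q _ _).1 hq
  obtain ⟨e, he⟩ := (RegTerm.eval_iff_exists_inner _ _ _ _).1 hq
  let Q := q.expand k
  let τ : Q.Vertex → (idemLang.{u, v, max u w} V).Term P.Vertex :=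
    RegTerm.place (.var P.source) (.var P.target) fun i => (e i).out.term
  have hτ : ∀ (B : Type (max u w)) [(idemLang.{u, v, max u w} V).Structure B],
      (idemReduct.{u, v, max u w} V).Mem B → IsAbelian (idemLang.{u, v, max u w} V) B →
      ∀ (b : P.Vertex → B) (i : Q.Vertex), (τ i).realize b =
        FreeAlg.lift b (RegTerm.place (g P.source) (g P.target) e i) := by
    intro B _ hB hB' b i
    match i with
    | .inl false => exact (FreeAlg.lift_gen ⟨hB, hB'⟩ b _).symm
    | .inl true => exact (FreeAlg.lift_gen ⟨hB, hB'⟩ b _).symm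
    | .inr i => rfl
  refine ⟨k, fun i => flat (τ i), rfl, rfl, ?_⟩
  rintro _ ⟨s, i, j, σ, hij, hσ, rfl⟩ B _ hB α hα a ha
  have : Nonempty P.Vertex := ⟨P.source⟩
  obtain ⟨D, _, hD, hD', d, hd, hcomm⟩ :=
    exists_abelian_quotient hB hα (fun i => a (σ i)) fun i j => ha _ _
  simp only [Term.realize_relabel]
  refine hcomm (τ i) (τ j) ?_
  rw [hτ D hD hD', hτ D hD hD']
  -- The assignment a ∘ σ is constant along the edges of G(p) labelled s, so it is one of those
  -- tested by `edgeCongruence`.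
  exact he s _ _ (RegTerm.hasEdge_place hij) D hD hD' d
    fun c c' hc => hd _ _ (congrArg a (hσ.2 _ _ (.rel _ _ hc)))

end Variety
end CommEq

theorem theorem5p3 (L : FirstOrder.Language.{u, v}) [L.IsAlgebraic] (V : CommEq.Variety L)
    {ι : Type z} (p q : CommEq.RelTerm ι) :
    (∀ (A : Type (max u w)) [(CommEq.Variety.idemLang.{u, v, max u w} V).Structure A],
        (CommEq.Variety.idemReduct.{u, v, max u w} V).Mem A →
        CommEq.IsAbelian (CommEq.Variety.idemLang.{u, v, max u w} V) A →
        CommEq.SatisfiesIncl (CommEq.Variety.idemLang.{u, v, max u w} V) A p q) ↔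
      CommEq.Variety.SatisfiesCommEqs.{u, v, max u w, z} V p q :=
  ⟨CommEq.Variety.satisfiesCommEqs_of_satisfiesIncl.{u, v, w, z},
    fun h A _ => CommEq.Variety.satisfiesIncl_of_satisfiesCommEqs h A⟩
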